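/- Let $K$ be a field, $\underline{x}=(x_1,\dots,x_d)$, and call $f\in K[[\underline{x}]][y]$ a Weierstrass polynomial if it is monic in $y$ and all its coefficients other than the leading one are non-units of $K[[\underline{x}]]$ (so the constant $1$ is a Weierstrass polynomial). The Newton polytope $\Delta(f)\subset\mathbb{R}^{d}\times\mathbb{R}$ of $f=\sum a_{\mathbf{i},j}\underline{x}^{\mathbf{i}}y^j$ is the convex hull of $\bigcup_{a_{\mathbf{i},j}\neq 0}\bigl((\mathbf{i},j)+\mathbb{R}_{\ge 0}^{d+1}\bigr)$; it is polygonal if the maximal dimension of its compact faces is one. For an integer $k\ge 1$ and $\mathbf{q}\in\mathbb{Q}_{\ge 0}^d$, the elementary polytope $\{\mathbf{q}/k\}$ is the convex hull of $\{(\mathbf{q},0),(\mathbf{0},k)\}+\mathbb{R}_{\ge 0}^{d+1}$, with inclination $\frac1k\mathbf{q}$; also $\{\infty/k\}:=\Delta(y^k)=(\mathbf{0},k)+\mathbb{R}_{\ge 0}^{d+1}$ is an elementary polytope, with inclination $\infty$. A canonical representation of a Newton polytope $\Delta$ is an equality $\Delta=\sum_{i=1}^r\{\mathbf{q}_i/k_i\}$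 (Minkowski sum, $\mathbf{q}_i\in\mathbb{Q}_{\ge0}^d\cup\{\infty\}$, $k_i\ge 1$ integers) in which the inclinations are pairwise different. Theorem. Let $f\in K[[\underline{x}]][y]$ be a Weierstrass polynomial such that $\Delta(f)$ is polygonal with canonical representation $\sum_{i=1}^r\{\mathbf{q}_i/k_i\}$. Then $f=f_1\cdots f_r$, where $f_1,\dots,f_r\in K[[\underline{x}]][y]$ are Weierstrass polynomials, not necessarily irreducible, with $\Delta(f_i)=\{\mathbf{q}_i/k_i\}$ for $i=1,\dots,r$. -/

import Mathlib

open scoped Pointwise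

namespace NewtonPoly

/-- A Weierstrass polynomial over `K[[x₁, …, x_d]]`: a monic polynomial in `y` all of whose
coefficients other than the leading one are non-units. The constant polynomial `1` is one. -/
def IsWeierstrass {K : Type*} [Field K] {d : ℕ}
    (f : Polynomial (MvPowerSeries (Fin d) K)) : Prop :=
  f.Monic ∧ ∀ j < f.natDegree, ¬ IsUnit (f.coeff j)

/-- The Newton polytope in `ℝ^d × ℝ` of `f = ∑ a_{i,j} x^i y^j`: the convex hull of the union of
the translated orthants `(i, j) + ℝ_{≥0}^{d+1}` over all `(i, j)` with `a_{i,j} ≠ 0`. -/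
def newtonPolytope {K : Type*} [Field K] {d : ℕ}
    (f : Polynomial (MvPowerSeries (Fin d) K)) : Set ((Fin d → ℝ) × ℝ) :=
  convexHull ℝ (⋃ (i : Fin d →₀ ℕ) (j : ℕ) (_ : MvPowerSeries.coeff i (f.coeff j) ≠ 0),
    ({((fun a => (i a : ℝ)), (j : ℝ))} + Set.Ici (0 : (Fin d → ℝ) × ℝ)))

/-- The elementary Newton polytope `{q / k}`. For `q ∈ ℚ_{≥0}^d` it is the convex hull of
`{(q, 0), (0, k)} + ℝ_{≥0}^{d+1}`; for `q = ∞` (written `⊤`) it is `(0, k) + ℝ_{≥0}^{d+1}`. -/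
def elementary {d : ℕ} (q : WithTop (Fin d → ℚ≥0)) (k : ℕ) : Set ((Fin d → ℝ) × ℝ) :=
  match q with
  | ⊤ => {((0 : Fin d → ℝ), (k : ℝ))} + Set.Ici 0
  | (q : Fin d → ℚ≥0) =>
      convexHull ℝ ({((fun a => ((q a : ℚ) : ℝ)), (0 : ℝ)), ((0 : Fin d → ℝ), (k : ℝ))}
        + Set.Ici 0)

/-- The inclination `q / k` of the elementary polytope `{q / k}`, equal to `∞` for `q = ∞`. -/
def inclination {d : ℕ} (q : WithTop (Fin d → ℚ≥0)) (k : ℕ) : WithTop (Fin d → ℚ≥0) :=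
  q.map fun v a => v a / (k : ℚ≥0)

/-- `P` is polygonal: the maximal dimension of its compact (nonempty) faces is one. Faces are cut
out by supporting hyperplanes, and the dimension is that of the affine span. -/
def IsPolygonal {d : ℕ} (P : Set ((Fin d → ℝ) × ℝ)) : Prop :=
  IsGreatest {n : ℕ | ∃ F : Set ((Fin d → ℝ) × ℝ), IsExposed ℝ P F ∧ F.Nonempty ∧ IsCompact F ∧
    Module.finrank ℝ (vectorSpan ℝ F) = n} 1

/-- `P = ∑ {q i / k i}` (Minkowski sum) is a canonical representation: the `k i` are positive
integers and terms of equal inclination have been summed up, so that the inclinations are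
pairwise different. -/
def IsCanonicalRep {d r : ℕ} (P : Set ((Fin d → ℝ) × ℝ))
    (q : Fin r → WithTop (Fin d → ℚ≥0)) (k : Fin r → ℕ) : Prop :=
  (∀ i, 0 < k i) ∧ (Function.Injective fun i => inclination (q i) (k i)) ∧
    P = ∑ i, elementary (q i) (k i)

end NewtonPoly

/-!
Splitting off a power of `y`, we may assume that all inclinations of `Δ(f)` are finite. If two of
them, `v` and `v'`, were incomparable for the product order, some linear form with positive
coefficients would agree on them, and the compact face it exposes would contain two independent
directions; so for a polygonal polytope the inclinations form a chain. Let `M` be the steepest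
inclination, with multiplicity `m`, and `v < M` the one before. The vertex of `Δ(f)` between the two
corresponding edges is `(Q, m)`, and its monomial `x^Q y^m` has the least (vector-valued) weight
both when `y` has weight `v` and when `y` has weight `M`. Hence, in weight `M`, the monomials of
`f` of `y`-degree greater than `m` lie at least `M - v` above the vertex. After normalizing the
coefficient of `y^m` to `x^Q`, the part of `f` of `y`-degree at most `m` is `x^Q` times a monic
polynomial, which a Newton iteration, gaining `M - v` in weight at each step, corrects to a divisor
of `f` of degree `m` with the single inclination `M`. The cofactor carries the remaining
inclinations, and one concludes by induction.
-/

namespace NewtonPoly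

open Polynomial Filter

/-! ### Weights of polynomials over power series -/

section Weight

variable {σ R : Type*} [CommRing R]

/-- The exponent `i` of the monomial `x^i`, seen as a point of `ℝ^σ`. -/
def realExponent (i : σ →₀ ℕ) : σ → ℝ := fun a => i a

theorem realExponent_zero : realExponent (0 : σ →₀ ℕ) = 0 := by
  ext
  simp [realExponent]

theorem realExponent_add (i i' : σ →₀ ℕ) :
    realExponent (i + i') = realExponent i + realExponent i' := by
  ext a
  simp [realExponent]

theorem realExponent_nonneg (i : σ →₀ ℕ) : 0 ≤ realExponent i := fun a => (i a).cast_nonneg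

theorem realExponent_le_realExponent {i i' : σ →₀ ℕ} :
    realExponent i ≤ realExponent i' ↔ i ≤ i' :=
  forall_congr' fun _ => Nat.cast_le

/-- The polynomials all of whose monomials `x^i y^j` satisfy `c ≤ i + j w`, where `y` carries the
vector weight `w`; inequalities are meant in every coordinate of `ℝ^σ`. -/
def weightGE (w c : σ → ℝ) : Submodule (MvPowerSeries σ R) (MvPowerSeries σ R)[X] where
  carrier := {P | ∀ i j, MvPowerSeries.coeff i (P.coeff j) ≠ 0 → c ≤ realExponent i + j • w}
  zero_mem' i j h := by simp at h
  add_mem' {P P'} hP hP' i j h := by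
    by_cases hi : MvPowerSeries.coeff i (P.coeff j) = 0
    · exact hP' i j (by simpa [hi] using h)
    · exact hP i j hi
  smul_mem' b P hP i j h := by
    classical
    rw [coeff_smul, smul_eq_mul, MvPowerSeries.coeff_mul] at h
    obtain ⟨⟨i₁, i₂⟩, hi, h⟩ := Finset.exists_ne_zero_of_sum_ne_zero h
    have hle : i₂ ≤ i := Finset.HasAntidiagonal.antidiagonal.snd_le hi
    exact (hP i₂ j (right_ne_zero_of_mul h)).trans
      (by gcongr; exact realExponent_le_realExponent.2 hle)

variable {w c c' : σ → ℝ} {P P' : (MvPowerSeries σ R)[X]}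

theorem weightGE_anti (h : c' ≤ c) : weightGE (R := R) w c ≤ weightGE w c' :=
  fun _ hP i j hij => h.trans (hP i j hij)

theorem exists_of_coeff_coeff_mul_ne_zero {i : σ →₀ ℕ} {j : ℕ}
    (h : MvPowerSeries.coeff i ((P * P').coeff j) ≠ 0) :
    ∃ i₁ i₂ j₁ j₂, i₁ + i₂ = i ∧ j₁ + j₂ = j ∧ MvPowerSeries.coeff i₁ (P.coeff j₁) ≠ 0 ∧
      MvPowerSeries.coeff i₂ (P'.coeff j₂) ≠ 0 := by
  classical
  rw [coeff_mul, map_sum] at h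
  obtain ⟨⟨j₁, j₂⟩, hj, h⟩ := Finset.exists_ne_zero_of_sum_ne_zero h
  rw [MvPowerSeries.coeff_mul] at h
  obtain ⟨⟨i₁, i₂⟩, hi, h⟩ := Finset.exists_ne_zero_of_sum_ne_zero h
  exact ⟨i₁, i₂, j₁, j₂, Finset.HasAntidiagonal.mem_antidiagonal.1 hi,
    Finset.HasAntidiagonal.mem_antidiagonal.1 hj, left_ne_zero_of_mul h, right_ne_zero_of_mul h⟩

theorem mul_mem_weightGE (hP : P ∈ weightGE w c) (hP' : P' ∈ weightGE w c') :
    P * P' ∈ weightGE w (c + c') := by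
  intro i j h
  obtain ⟨i₁, i₂, j₁, j₂, rfl, rfl, h₁, h₂⟩ := exists_of_coeff_coeff_mul_ne_zero h
  calc c + c' ≤ (realExponent i₁ + j₁ • w) + (realExponent i₂ + j₂ • w) :=
        add_le_add (hP _ _ h₁) (hP' _ _ h₂)
    _ = realExponent (i₁ + i₂) + (j₁ + j₂) • w := by rw [realExponent_add]; module

theorem C_coeff_mul_X_pow_mem_weightGE (hP : P ∈ weightGE w c) {m n : ℕ} (hmn : m ≤ n) :
    C (P.coeff n) * X ^ (n - m) ∈ weightGE w (c - m • w) := by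
  intro i j h
  obtain rfl : j = n - m := by
    by_contra hj
    simp [hj] at h
  have hi : c ≤ realExponent i + n • w := hP i n (by simpa using h)
  calc c - m • w ≤ realExponent i + n • w - m • w := sub_le_sub_right hi _
    _ = realExponent i + (n - m) • w := by
        nth_rewrite 1 [← Nat.sub_add_cancel hmn]
        module

theorem exists_nat_not_nsmul_le {ε : σ → ℝ} (hε : 0 < ε) (x : σ → ℝ) : ∃ n : ℕ, ¬ n • ε ≤ x := by
  obtain ⟨-, a, ha⟩ := Pi.lt_def.1 hε
  obtain ⟨n, hn⟩ := exists_lt_nsmul ha (x a)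
  exact ⟨n, fun h => (h a).not_gt hn⟩

theorem eq_zero_of_forall_mem_weightGE {ε : σ → ℝ} (hε : 0 < ε)
    (h : ∀ n : ℕ, P ∈ weightGE w (c + n • ε)) : P = 0 := by
  ext j i
  by_contra hne
  obtain ⟨n, hn⟩ := exists_nat_not_nsmul_le hε (realExponent i + j • w - c)
  exact hn (le_sub_iff_add_le'.2 (h n i j (by simpa using hne)))

theorem monomial_dvd_of_forall_le {φ : MvPowerSeries σ R} {Q : σ →₀ ℕ}
    (h : ∀ i, MvPowerSeries.coeff i φ ≠ 0 → Q ≤ i) : MvPowerSeries.monomial Q 1 ∣ φ := by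
  classical
  obtain ⟨ψ, hψ⟩ : ∃ ψ : MvPowerSeries σ R, ∀ i,
      MvPowerSeries.coeff i ψ = MvPowerSeries.coeff (Q + i) φ := ⟨_, fun _ => rfl⟩
  refine ⟨ψ, MvPowerSeries.ext fun i => ?_⟩
  rw [MvPowerSeries.coeff_monomial_mul]
  split_ifs with hQ
  · rw [one_mul, hψ, add_tsub_cancel_of_le hQ]
  · by_contra hne
    exact hQ (h i hne)

theorem isLeftRegular_monomial_one (Q : σ →₀ ℕ) :
    IsLeftRegular (MvPowerSeries.monomial Q (1 : R)) := fun φ ψ h => by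
  ext i
  have hi := congrArg (MvPowerSeries.coeff (Q + i)) h
  simpa only [MvPowerSeries.coeff_add_monomial_mul, one_mul] using hi

theorem degree_le_degree_C_monomial_mul (Q : σ →₀ ℕ) :
    P.degree ≤ (C (MvPowerSeries.monomial Q 1) * P).degree := by
  refine degree_mono fun j hj => ?_
  rw [mem_support_iff] at hj ⊢
  rwa [coeff_C_mul, ne_eq, (isLeftRegular_monomial_one Q).mul_left_eq_zero_iff]

theorem mem_weightGE_of_C_monomial_mul {Q : σ →₀ ℕ}
    (h : C (MvPowerSeries.monomial Q 1) * P ∈ weightGE w (realExponent Q + c)) :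
    P ∈ weightGE w c := by
  intro i j hij
  have hQ := h (Q + i) j (by rwa [coeff_C_mul, MvPowerSeries.coeff_add_monomial_mul, one_mul])
  rwa [realExponent_add, add_assoc, add_le_add_iff_left] at hQ

theorem C_monomial_dvd_of_mem_weightGE (hw : 0 ≤ w) {Q : σ →₀ ℕ} {m : ℕ} (hm : P.natDegree ≤ m)
    (hP : P ∈ weightGE w (realExponent Q + m • w)) : C (MvPowerSeries.monomial Q 1) ∣ P := by
  refine (C_dvd_iff_dvd_coeff _ _).2 fun j => monomial_dvd_of_forall_le fun i hij => ?_
  have hj : j ≤ m := (le_natDegree_of_ne_zero fun h0 => hij (by simp [h0])).trans hm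
  rw [← realExponent_le_realExponent, ← add_le_add_iff_right (j • w)]
  exact (add_le_add_right (nsmul_le_nsmul_left hw hj) _).trans (hP i j hij)

/-- Monic polynomials of `y`-degree `n` all of whose monomials have weight at least that of `y^n`.
Equivalently, all inclinations of their Newton polytopes are at least `w`. -/
structure MonicSlopeGE (w : σ → ℝ) (h : (MvPowerSeries σ R)[X]) : Prop where
  monic : h.Monic
  mem_weightGE : h ∈ weightGE w (h.natDegree • w)

theorem MonicSlopeGE.anti {w' : σ → ℝ} {h : (MvPowerSeries σ R)[X]} (hh : MonicSlopeGE w h)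
    (hw : w' ≤ w) : MonicSlopeGE w' h := by
  refine ⟨hh.monic, fun i j hij => ?_⟩
  have hj : j ≤ h.natDegree := le_natDegree_of_ne_zero fun h0 => hij (by simp [h0])
  obtain ⟨l, hl⟩ := Nat.exists_eq_add_of_le hj
  have hle : h.natDegree • w ≤ realExponent i + j • w := hh.mem_weightGE i j hij
  rw [hl, add_nsmul, add_comm, add_le_add_iff_right] at hle ⊢
  exact (nsmul_le_nsmul_right hw l).trans hle

variable [Nontrivial R]

theorem MonicSlopeGE.exists_div_mod {h : (MvPowerSeries σ R)[X]} (hh : MonicSlopeGE w h) :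
    P ∈ weightGE w c → ∃ q r, r + h * q = P ∧ r.degree < h.degree ∧
      q ∈ weightGE w (c - h.natDegree • w) ∧ r ∈ weightGE w c := by
  induction P using degree_lt_wf.induction with
  | _ P ih =>
  intro hP
  by_cases hd : P.degree < h.degree
  · exact ⟨0, P, by simp, hd, zero_mem _, hP⟩
  have hle : h.degree ≤ P.degree := not_lt.mp hd
  have hP0 : P ≠ 0 := by
    rintro rfl
    exact hd (by simpa [bot_lt_iff_ne_bot] using hh.monic.ne_zero)
  set T := C P.leadingCoeff * X ^ (P.natDegree - h.natDegree)
  have hT : T ∈ weightGE w (c - h.natDegree • w) :=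
    C_coeff_mul_X_pow_mem_weightGE hP (natDegree_le_natDegree hle)
  have hhT : h * T ∈ weightGE w c :=
    weightGE_anti (add_sub_cancel _ _).ge (mul_mem_weightGE hh.mem_weightGE hT)
  obtain ⟨q, r, hqr, hr, hq, hrw⟩ :=
    ih _ (div_wf_lemma ⟨hle, hP0⟩ hh.monic) (sub_mem hP hhT)
  exact ⟨q + T, r, by linear_combination hqr, hr, add_mem hq hT, hrw⟩

theorem MonicSlopeGE.divByMonic_mem_weightGE {h : (MvPowerSeries σ R)[X]}
    (hh : MonicSlopeGE w h) (hP : P ∈ weightGE w c) :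
    P /ₘ h ∈ weightGE w (c - h.natDegree • w) := by
  obtain ⟨q, r, hqr, hr, hq, -⟩ := hh.exists_div_mod hP
  rwa [(div_modByMonic_unique q r hh.monic ⟨hqr, hr⟩).1]

theorem MonicSlopeGE.modByMonic_mem_weightGE {h : (MvPowerSeries σ R)[X]}
    (hh : MonicSlopeGE w h) (hP : P ∈ weightGE w c) : P %ₘ h ∈ weightGE w c := by
  obtain ⟨q, r, hqr, hr, -, hrw⟩ := hh.exists_div_mod hP
  rwa [(div_modByMonic_unique q r hh.monic ⟨hqr, hr⟩).2]

end Weight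

/-! ### Hensel factorization at a vertex -/

section Hensel

variable {σ R : Type*} [CommRing R]

theorem exists_natDegree_le_and_eventually_coeff_eq {h : ℕ → (MvPowerSeries σ R)[X]} {m : ℕ}
    (hdeg : ∀ n, (h n).natDegree ≤ m)
    (hh : ∀ i j, ∃ x, ∀ᶠ n in atTop, MvPowerSeries.coeff i ((h n).coeff j) = x) :
    ∃ H : (MvPowerSeries σ R)[X], H.natDegree ≤ m ∧ ∀ i j,
      ∀ᶠ n in atTop, MvPowerSeries.coeff i ((h n).coeff j) = MvPowerSeries.coeff i (H.coeff j) := by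
  choose x hx using hh
  obtain ⟨co, hco⟩ : ∃ co : ℕ → MvPowerSeries σ R, ∀ i j, MvPowerSeries.coeff i (co j) = x i j :=
    ⟨fun j i => x i j, fun _ _ => rfl⟩
  refine ⟨PowerSeries.trunc (m + 1) (PowerSeries.mk co),
    Nat.lt_succ_iff.1 (PowerSeries.natDegree_trunc_lt _ _), fun i j => ?_⟩
  rw [PowerSeries.coeff_trunc]
  split_ifs with hj
  · rw [PowerSeries.coeff_mk, hco]
    exact hx i j
  · refine .of_forall fun n => ?_
    rw [coeff_eq_zero_of_natDegree_lt ((hdeg n).trans_lt (by lia))]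

variable {w c ε : σ → ℝ}

theorem sub_mem_weightGE_of_le (hε : 0 ≤ ε) {h : ℕ → (MvPowerSeries σ R)[X]}
    (hh : ∀ n : ℕ, h (n + 1) - h n ∈ weightGE w (c + n • ε)) {n l : ℕ} (hnl : n ≤ l) :
    h l - h n ∈ weightGE w (c + n • ε) := by
  induction l, hnl using Nat.le_induction with
  | base => simp
  | succ l hnl ih =>
    rw [← sub_add_sub_cancel]
    exact add_mem (weightGE_anti (by gcongr) (hh l)) ih

theorem exists_limit (hε : 0 < ε) {h : ℕ → (MvPowerSeries σ R)[X]} {m : ℕ}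
    (hdeg : ∀ n, (h n).natDegree ≤ m)
    (hh : ∀ n : ℕ, h (n + 1) - h n ∈ weightGE w (c + n • ε)) :
    ∃ H : (MvPowerSeries σ R)[X], H.natDegree ≤ m ∧ (∀ n : ℕ, H - h n ∈ weightGE w (c + n • ε)) ∧
      ∀ i j, ∀ᶠ n in atTop,
        MvPowerSeries.coeff i ((h n).coeff j) = MvPowerSeries.coeff i (H.coeff j) := by
  have hconst (i j) : ∃ x, ∀ᶠ n in atTop, MvPowerSeries.coeff i ((h n).coeff j) = x := by
    obtain ⟨N, hN⟩ := exists_nat_not_nsmul_le hε (realExponent i + j • w - c)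
    refine ⟨MvPowerSeries.coeff i ((h N).coeff j), eventually_atTop.2 ⟨N, fun n hn => ?_⟩⟩
    rw [← sub_eq_zero, ← map_sub, ← coeff_sub]
    by_contra hne
    exact hN (le_sub_iff_add_le'.2 (sub_mem_weightGE_of_le hε.le hh hn i j hne))
  obtain ⟨H, hHdeg, hH⟩ := exists_natDegree_le_and_eventually_coeff_eq hdeg hconst
  refine ⟨H, hHdeg, fun n i j hij => ?_, hH⟩
  obtain ⟨l, hl, hnl⟩ := ((hH i j).and (eventually_ge_atTop n)).exists
  rw [coeff_sub, map_sub, ← hl, ← map_sub, ← coeff_sub] at hij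
  exact sub_mem_weightGE_of_le hε.le hh hnl i j hij

/-- `h` is a factor of `f` of degree `m` up to an error of weight `δ` above that of the vertex
`(Q, m)` of `f`, with a cofactor which is `x^Q` up to an error of weight `ε`. -/
structure IsApproxFactor (w ε : σ → ℝ) (Q : σ →₀ ℕ) (m : ℕ) (f : (MvPowerSeries σ R)[X])
    (δ : σ → ℝ) (h : (MvPowerSeries σ R)[X]) : Prop where
  slope : MonicSlopeGE w h
  natDegree_eq : h.natDegree = m
  mod_mem : f %ₘ h ∈ weightGE w (realExponent Q + m • w + δ)
  div_sub_mem : f /ₘ h - C (MvPowerSeries.monomial Q 1) ∈ weightGE w (realExponent Q + ε)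

variable [Nontrivial R] {δ : σ → ℝ} {Q : σ →₀ ℕ} {m : ℕ} {f g h E : (MvPowerSeries σ R)[X]}

theorem IsApproxFactor.of_eq (hh : MonicSlopeGE w h) (hm : h.natDegree = m) (hf : f = g * h + E)
    (hg : g - C (MvPowerSeries.monomial Q 1) ∈ weightGE w (realExponent Q + ε))
    (hE : E ∈ weightGE w (realExponent Q + m • w + δ)) (hεδ : ε ≤ δ) :
    IsApproxFactor w ε Q m f δ h := by
  have heq : E %ₘ h + h * (g + E /ₘ h) = f := by
    linear_combination modByMonic_add_div E h - hf
  obtain ⟨hdiv, hmod⟩ := div_modByMonic_unique _ _ hh.monic ⟨heq, degree_modByMonic_lt E hh.monic⟩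
  refine ⟨hh, hm, hmod ▸ hh.modByMonic_mem_weightGE hE, ?_⟩
  rw [hdiv, add_sub_right_comm]
  refine add_mem hg (weightGE_anti ?_ (hh.divByMonic_mem_weightGE hE))
  rw [hm, add_right_comm, add_sub_cancel_right]
  gcongr

theorem exists_isApproxFactor (hw : 0 ≤ w) (hQ : f.coeff m = MvPowerSeries.monomial Q 1)
    (hf : f ∈ weightGE w (realExponent Q + m • w))
    (hhigh : ∀ i j, m < j → MvPowerSeries.coeff i (f.coeff j) ≠ 0 →
      realExponent Q + m • w + ε ≤ realExponent i + j • w) :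
    ∃ h, IsApproxFactor w ε Q m f ε h := by
  set low : (MvPowerSeries σ R)[X] := PowerSeries.trunc (m + 1) f
  have hcoeff (j) : low.coeff j = if j < m + 1 then f.coeff j else 0 := by
    rw [PowerSeries.coeff_trunc, coeff_coe]
  have hdeg : low.natDegree ≤ m := Nat.lt_succ_iff.1 (PowerSeries.natDegree_trunc_lt _ _)
  have hlow : low ∈ weightGE w (realExponent Q + m • w) := by
    intro i j hij
    rw [hcoeff] at hij
    split_ifs at hij with hj
    · exact hf i j hij
    · simp at hij
  have hrest : f - low ∈ weightGE w (realExponent Q + m • w + ε) := by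
    intro i j hij
    rw [coeff_sub, hcoeff] at hij
    split_ifs at hij with hj
    · simp at hij
    · exact hhigh i j (by lia) (by simpa using hij)
  obtain ⟨h, hh⟩ := C_monomial_dvd_of_mem_weightGE hw hdeg hlow
  have hhm : h.coeff m = 1 := by
    have hm := hcoeff m
    rw [if_pos m.lt_succ_self, hQ, hh, coeff_C_mul] at hm
    exact isLeftRegular_monomial_one Q (hm.trans (mul_one _).symm)
  have hhdeg : h.natDegree ≤ m := natDegree_le_iff_degree_le.2
    ((degree_le_degree_C_monomial_mul Q).trans (hh ▸ degree_le_of_natDegree_le hdeg))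
  have hhdeg' : h.natDegree = m :=
    hhdeg.antisymm (le_natDegree_of_ne_zero (hhm ▸ one_ne_zero))
  have hslope : MonicSlopeGE w h :=
    ⟨monic_of_natDegree_le_of_coeff_eq_one m hhdeg hhm,
      hhdeg'.symm ▸ mem_weightGE_of_C_monomial_mul (hh ▸ hlow)⟩
  exact ⟨h, .of_eq hslope hhdeg' (by rw [← hh, add_sub_cancel]) (by simp) hrest le_rfl⟩

/-- One step of the iteration: dividing the remainder `f %ₘ h` by the leading term `x^Q` of the
cofactor gives the correction of `h`. -/
theorem IsApproxFactor.exists_next (hw : 0 ≤ w) (hε : 0 ≤ ε) (hδ : ε ≤ δ)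
    (hh : IsApproxFactor w ε Q m f δ h) :
    ∃ h', IsApproxFactor w ε Q m f (δ + ε) h' ∧ h' - h ∈ weightGE w (m • w + δ) := by
  have hδ₀ : 0 ≤ δ := hε.trans hδ
  have hmod : f %ₘ h ∈ weightGE w (realExponent Q + (m • w + δ)) := by
    rw [← add_assoc]
    exact hh.mod_mem
  have hdeg : (f %ₘ h).degree < h.degree := degree_modByMonic_lt f hh.slope.monic
  obtain ⟨ρ, hρ⟩ := C_monomial_dvd_of_mem_weightGE hw (Q := Q)
    (hh.natDegree_eq ▸ natDegree_le_natDegree hdeg.le) (weightGE_anti (by simpa using hδ₀) hmod)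
  have hρw : ρ ∈ weightGE w (m • w + δ) := mem_weightGE_of_C_monomial_mul (hρ ▸ hmod)
  have hρdeg : ρ.degree < h.degree := (degree_le_degree_C_monomial_mul Q).trans_lt (hρ ▸ hdeg)
  have hm : (h + ρ).natDegree = m :=
    (natDegree_add_eq_left_of_degree_lt hρdeg).trans hh.natDegree_eq
  have hslope : MonicSlopeGE w (h + ρ) := by
    refine ⟨hh.slope.monic.add_of_left hρdeg, hm.symm ▸ add_mem ?_ ?_⟩
    · exact hh.natDegree_eq ▸ hh.slope.mem_weightGE
    · exact weightGE_anti (by simpa using hδ₀) hρw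
  refine ⟨h + ρ, .of_eq (E := -((f /ₘ h - C (MvPowerSeries.monomial Q 1)) * ρ)) hslope hm ?_
    hh.div_sub_mem (neg_mem ?_) (hδ.trans (by simpa using hε)), by simpa using hρw⟩
  · linear_combination hρ - modByMonic_add_div f h
  · exact weightGE_anti (by apply le_of_eq; abel) (mul_mem_weightGE hh.div_sub_mem hρw)

theorem IsApproxFactor.modByMonic_mem_weightGE_of_sub_mem {H : (MvPowerSeries σ R)[X]}
    (hf : f ∈ weightGE w (realExponent Q + m • w))
    (hh : IsApproxFactor w ε Q m f δ h) (hH : MonicSlopeGE w H)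
    (hHh : H - h ∈ weightGE w (m • w + δ)) :
    f %ₘ H ∈ weightGE w (realExponent Q + m • w + δ) := by
  have hdiv : f /ₘ h ∈ weightGE w (realExponent Q) := by
    have := hh.slope.divByMonic_mem_weightGE hf
    rwa [hh.natDegree_eq, add_sub_cancel_right] at this
  have hdvd : H ∣ f - (f %ₘ h - f /ₘ h * (H - h)) :=
    ⟨f /ₘ h, by linear_combination -modByMonic_add_div f h⟩
  rw [modByMonic_eq_of_dvd_sub hH.monic hdvd]
  refine hH.modByMonic_mem_weightGE (sub_mem hh.mod_mem ?_)
  rw [add_assoc]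
  exact mul_mem_weightGE hdiv hHh

theorem exists_monicSlopeGE_dvd_of_coeff_eq_monomial (hw : 0 ≤ w) (hε : 0 < ε)
    (hQ : f.coeff m = MvPowerSeries.monomial Q 1) (hf : f ∈ weightGE w (realExponent Q + m • w))
    (hhigh : ∀ i j, m < j → MvPowerSeries.coeff i (f.coeff j) ≠ 0 →
      realExponent Q + m • w + ε ≤ realExponent i + j • w) :
    ∃ h, MonicSlopeGE w h ∧ h.natDegree = m ∧ h ∣ f := by
  have hδ (n : ℕ) : ε ≤ ε + n • ε := le_add_of_nonneg_right (nsmul_nonneg hε.le n)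
  obtain ⟨h₀, hh₀⟩ := exists_isApproxFactor hw hQ hf hhigh
  choose! next hnext hsub using fun (n : ℕ) h (hh : IsApproxFactor w ε Q m f (ε + n • ε) h) =>
    hh.exists_next hw hε.le (hδ n)
  let s : ℕ → (MvPowerSeries σ R)[X] := fun n => Nat.rec h₀ next n
  have hs (n : ℕ) : IsApproxFactor w ε Q m f (ε + n • ε) (s n) := by
    induction n with
    | zero => simpa [s] using hh₀
    | succ n ih =>
      rw [succ_nsmul, ← add_assoc]
      exact hnext n _ ih
  obtain ⟨H, hHdeg, hHs, hHcoeff⟩ := exists_limit (c := m • w + ε) hε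
    (fun n => (hs n).natDegree_eq.le) (fun n => by rw [add_assoc]; exact hsub n _ (hs n))
  have hHm : H.coeff m = 1 := by
    ext i
    obtain ⟨n, hn⟩ := (hHcoeff i m).exists
    rw [← hn, ← (hs n).slope.monic.coeff_natDegree, (hs n).natDegree_eq]
  have hHdeg' : H.natDegree = m := hHdeg.antisymm (le_natDegree_of_ne_zero (hHm ▸ one_ne_zero))
  have hH : MonicSlopeGE w H := by
    refine ⟨monic_of_natDegree_le_of_coeff_eq_one m hHdeg hHm, ?_⟩
    rw [hHdeg', ← sub_add_cancel H (s 0)]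
    refine add_mem (weightGE_anti ?_ (hHs 0)) ((hs 0).natDegree_eq ▸ (hs 0).slope.mem_weightGE)
    simpa using hε.le
  refine ⟨H, hH, hHdeg', (modByMonic_eq_zero_iff_dvd hH.monic).1 ?_⟩
  refine eq_zero_of_forall_mem_weightGE (w := w) (c := realExponent Q + m • w + ε) hε fun n => ?_
  rw [add_assoc]
  exact (hs n).modByMonic_mem_weightGE_of_sub_mem hf hH (by rw [← add_assoc]; exact hHs n)

/-- Multiplying `f` by a unit turns its coefficient at the vertex into the monomial `x^Q`. -/
theorem exists_monicSlopeGE_dvd_of_vertex {w' : σ → ℝ} (hw : 0 ≤ w) (hw' : w' < w)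
    (hQ : IsUnit (MvPowerSeries.coeff Q (f.coeff m)))
    (hf : f ∈ weightGE w (realExponent Q + m • w))
    (hf' : f ∈ weightGE w' (realExponent Q + m • w')) :
    ∃ h, MonicSlopeGE w h ∧ h.natDegree = m ∧ h ∣ f := by
  obtain ⟨u, hu⟩ := monomial_dvd_of_forall_le (φ := f.coeff m) (Q := Q) fun i hi =>
    realExponent_le_realExponent.1 ((add_le_add_iff_right _).1 (hf i m hi))
  have hu' : IsUnit u := by
    have hcoeff := MvPowerSeries.coeff_add_monomial_mul Q 0 u (1 : R)
    rw [add_zero, ← hu, one_mul, MvPowerSeries.coeff_zero_eq_constantCoeff_apply] at hcoeff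
    exact MvPowerSeries.isUnit_iff_constantCoeff.2 (hcoeff ▸ hQ)
  obtain ⟨v, rfl⟩ := hu'
  have hcoeff : (C (v⁻¹ : (MvPowerSeries σ R)ˣ).val * f).coeff m = MvPowerSeries.monomial Q 1 := by
    rw [coeff_C_mul, hu, mul_comm, mul_assoc, Units.mul_inv, mul_one]
  have hsmul {w c : σ → ℝ} (hfc : f ∈ weightGE w c) : C (v⁻¹).val * f ∈ weightGE w c :=
    smul_eq_C_mul (R := MvPowerSeries σ R) v⁻¹.val ▸ Submodule.smul_mem _ _ hfc
  obtain ⟨h, hh, hm, hdvd⟩ := exists_monicSlopeGE_dvd_of_coeff_eq_monomial hw (sub_pos.2 hw')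
    hcoeff (hsmul hf) fun i j hj hij => by
      obtain ⟨l, rfl⟩ := Nat.exists_eq_add_of_lt hj
      have hd : 0 ≤ w - w' := (sub_pos.2 hw').le
      calc realExponent Q + m • w + (w - w')
          = realExponent Q + m • w' + (m + 1) • (w - w') := by module
        _ ≤ realExponent i + (m + l + 1) • w' + (m + l + 1) • (w - w') :=
          add_le_add (hsmul hf' i _ hij) (nsmul_le_nsmul_left hd (by lia))
        _ = realExponent i + (m + l + 1) • w := by module
  exact ⟨h, hh, hm, (IsUnit.dvd_mul_left (v⁻¹.isUnit.map C)).1 hdvd⟩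

end Hensel

/-! ### Factorization along a chain of slopes -/

section Slopes

variable {σ R ι : Type*} [CommRing R] {w w' : σ → ℝ}

theorem coeff_coeff_ne_zero_of_mul {g h : (MvPowerSeries σ R)[X]} {i : σ →₀ ℕ} {j : ℕ}
    (hw : w' < w) (hg : g ∈ weightGE w' (realExponent i + j • w')) (hh : MonicSlopeGE w h)
    (hij : MvPowerSeries.coeff i ((h * g).coeff (h.natDegree + j)) ≠ 0) :
    MvPowerSeries.coeff i (g.coeff j) ≠ 0 := by
  obtain ⟨i₂, i₁, j₂, j₁, rfl, hj, h₂, h₁⟩ := exists_of_coeff_coeff_mul_ne_zero hij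
  obtain ⟨l, hl⟩ := Nat.exists_eq_add_of_le
    (le_natDegree_of_ne_zero fun h0 : h.coeff j₂ = 0 => h₂ (by simp [h0]))
  obtain rfl : j₁ = l + j := by lia
  have hlower : l • w ≤ realExponent i₂ := by
    have := hh.mem_weightGE i₂ j₂ h₂
    rwa [hl, add_comm j₂, add_nsmul, add_le_add_iff_right] at this
  have hupper : realExponent i₂ ≤ l • w' := by
    have := hg i₁ _ h₁
    rwa [realExponent_add, add_nsmul, add_comm (realExponent i₂), add_assoc,
      add_le_add_iff_left, add_le_add_iff_right] at this
  obtain rfl : l = 0 := by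
    by_contra hl0
    exact (nsmul_lt_nsmul_right hl0 hw).not_ge (hlower.trans hupper)
  obtain rfl : i₂ = 0 := nonpos_iff_eq_zero.1 <| realExponent_le_realExponent.1 <|
    hupper.trans <| by simpa using realExponent_nonneg 0
  simpa using h₁

theorem exists_coeff_ne_zero_of_coeff_mul {φ ψ : MvPowerSeries σ R} {c c' : σ → ℝ} {i : σ →₀ ℕ}
    (hφ : ∀ i, MvPowerSeries.coeff i φ ≠ 0 → c ≤ realExponent i)
    (hψ : ∀ i, MvPowerSeries.coeff i ψ ≠ 0 → c' ≤ realExponent i)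
    (hi : realExponent i = c + c') (h : MvPowerSeries.coeff i (φ * ψ) ≠ 0) :
    ∃ i', realExponent i' = c ∧ MvPowerSeries.coeff i' φ ≠ 0 := by
  classical
  rw [MvPowerSeries.coeff_mul] at h
  obtain ⟨⟨i₁, i₂⟩, hi₁₂, h⟩ := Finset.exists_ne_zero_of_sum_ne_zero h
  have h₁ := left_ne_zero_of_mul h
  refine ⟨i₁, ?_, h₁⟩
  rw [← Finset.HasAntidiagonal.mem_antidiagonal.1 hi₁₂, realExponent_add] at hi
  exact ((add_eq_add_iff_eq_and_eq (hφ i₁ h₁) (hψ i₂ (right_ne_zero_of_mul h))).1 hi.symm).1.symm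

open scoped Classical in
/-- The `x`-exponent of the vertex of `∑ t ∈ S, {k t • v t / k t}` separating the slopes `≤ w` from
the others. -/
noncomputable def vertexExponent (S : Finset ι) (v : ι → σ → ℝ) (k : ι → ℕ) (w : σ → ℝ) : σ → ℝ :=
  ∑ t ∈ S with v t ≤ w, k t • v t

open scoped Classical in
/-- The `y`-exponent of the vertex of `∑ t ∈ S, {k t • v t / k t}` separating the slopes `≤ w` from
the others. -/
noncomputable def vertexDegree (S : Finset ι) (v : ι → σ → ℝ) (k : ι → ℕ) (w : σ → ℝ) : ℕ :=
  ∑ t ∈ S with ¬ v t ≤ w, k t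

/-- `f` has the slopes `v t` with multiplicities `k t`, for `t ∈ S`: it is monic of degree `∑ k t`,
and for every `s ∈ S` the vertex at which the slope `v s` begins belongs to the support of `f` and
has the least weight when `y` is given the weight `v s`. -/
structure HasSlopes {K : Type*} [Field K] (S : Finset ι) (v : ι → σ → ℝ) (k : ι → ℕ)
    (f : (MvPowerSeries σ K)[X]) : Prop where
  monic : f.Monic
  natDegree_eq : f.natDegree = ∑ t ∈ S, k t
  vertex : ∀ s ∈ S, ∃ i, realExponent i = vertexExponent S v k (v s) ∧
    MvPowerSeries.coeff i (f.coeff (vertexDegree S v k (v s))) ≠ 0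
  weight : ∀ s ∈ S, f ∈ weightGE (v s)
    (vertexExponent S v k (v s) + vertexDegree S v k (v s) • v s)

variable {S : Finset ι} {v : ι → σ → ℝ} {k : ι → ℕ}

theorem vertexExponent_of_forall_le (h : ∀ t ∈ S, v t ≤ w) :
    vertexExponent S v k w = ∑ t ∈ S, k t • v t := by
  classical
  rw [vertexExponent, Finset.filter_true_of_mem h]

theorem vertexDegree_of_forall_le (h : ∀ t ∈ S, v t ≤ w) : vertexDegree S v k w = 0 := by
  classical
  rw [vertexDegree, Finset.filter_false_of_mem fun t ht => not_not.2 (h t ht), Finset.sum_empty]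

theorem vertexExponent_insert_of_not_le [DecidableEq ι] {M : ι} (h : ¬ v M ≤ w) :
    vertexExponent (insert M S) v k w = vertexExponent S v k w := by
  rw [vertexExponent, Finset.filter_insert, if_neg h, vertexExponent]

theorem vertexDegree_insert_of_not_le [DecidableEq ι] {M : ι} (hM : M ∉ S) (h : ¬ v M ≤ w) :
    vertexDegree (insert M S) v k w = k M + vertexDegree S v k w := by
  classical
  rw [vertexDegree, Finset.filter_insert, if_pos h,
    Finset.sum_insert fun hM' => hM (Finset.mem_filter.1 hM').1, vertexDegree]

theorem exists_forall_le_of_isChain (hS : S.Nonempty) (hc : IsChain (· ≤ ·) (v '' S)) :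
    ∃ s ∈ S, ∀ t ∈ S, v t ≤ v s := by
  obtain ⟨s, hs, hmax⟩ := S.exists_maximalFor v hS
  exact ⟨s, hs, fun t ht =>
    (hc.total (Set.mem_image_of_mem v ht) (Set.mem_image_of_mem v hs)).elim id (hmax ht)⟩

variable {K : Type*} [Field K] {f g h : (MvPowerSeries σ K)[X]} {M : ι}

theorem HasSlopes.mem_weightGE_of_forall_le (hf : HasSlopes S v k f) {s : ι} (hs : s ∈ S)
    (hmax : ∀ t ∈ S, v t ≤ v s) : f ∈ weightGE (v s) (∑ t ∈ S, k t • v t) := by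
  have := hf.weight s hs
  rwa [vertexExponent_of_forall_le hmax, vertexDegree_of_forall_le hmax, zero_nsmul,
    add_zero] at this

theorem HasSlopes.exists_vertex_of_forall_le (hf : HasSlopes S v k f) {s : ι} (hs : s ∈ S)
    (hmax : ∀ t ∈ S, v t ≤ v s) :
    ∃ i, realExponent i = ∑ t ∈ S, k t • v t ∧ MvPowerSeries.coeff i (f.coeff 0) ≠ 0 := by
  have := hf.vertex s hs
  rwa [vertexExponent_of_forall_le hmax, vertexDegree_of_forall_le hmax] at this

theorem HasSlopes.sum_le_realExponent (hf : HasSlopes S v k f) (hc : IsChain (· ≤ ·) (v '' S))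
    (i : σ →₀ ℕ) (hi : MvPowerSeries.coeff i (f.coeff 0) ≠ 0) :
    ∑ t ∈ S, k t • v t ≤ realExponent i := by
  rcases S.eq_empty_or_nonempty with rfl | hS
  · simpa using realExponent_nonneg i
  obtain ⟨s, hs, hmax⟩ := exists_forall_le_of_isChain hS hc
  simpa using hf.mem_weightGE_of_forall_le hs hmax i 0 hi

theorem HasSlopes.exists_monicSlopeGE_dvd [DecidableEq ι] (hf : HasSlopes (insert M S) v k f)
    (hM : M ∉ S) (hpos : 0 ≤ v M) (hlt : ∀ t ∈ S, v t < v M) (hc : IsChain (· ≤ ·) (v '' S)) :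
    ∃ h, MonicSlopeGE (v M) h ∧ h.natDegree = k M ∧ h ∣ f := by
  have hfM := hf.mem_weightGE_of_forall_le (Finset.mem_insert_self M S) fun t ht =>
    (Finset.mem_insert.1 ht).elim (fun h => h ▸ le_rfl) fun ht => (hlt t ht).le
  rw [Finset.sum_insert hM] at hfM
  rcases S.eq_empty_or_nonempty with rfl | hS
  · have hdeg : f.natDegree = k M := by simpa using hf.natDegree_eq
    exact ⟨f, ⟨hf.monic, by simpa [hdeg] using hfM⟩, hdeg, dvd_rfl⟩
  obtain ⟨s, hs, hmax⟩ := exists_forall_le_of_isChain hS hc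
  have hMs : ¬ v M ≤ v s := (hlt s hs).not_ge
  have hexp : vertexExponent (insert M S) v k (v s) = ∑ t ∈ S, k t • v t := by
    rw [vertexExponent_insert_of_not_le hMs, vertexExponent_of_forall_le hmax]
  have hdeg : vertexDegree (insert M S) v k (v s) = k M := by
    rw [vertexDegree_insert_of_not_le hM hMs, vertexDegree_of_forall_le hmax, add_zero]
  have hfs := hf.weight s (Finset.mem_insert_of_mem hs)
  obtain ⟨Q, hQ, hQf⟩ := hf.vertex s (Finset.mem_insert_of_mem hs)
  rw [hexp] at hQ
  rw [hdeg] at hQf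
  rw [hexp, hdeg, ← hQ] at hfs
  rw [add_comm, ← hQ] at hfM
  exact exists_monicSlopeGE_dvd_of_vertex hpos (hlt s hs) hQf.isUnit hfM hfs

theorem HasSlopes.of_insert_mul [DecidableEq ι] (hf : HasSlopes (insert M S) v k (h * g))
    (hM : M ∉ S) (hlt : ∀ t ∈ S, v t < v M) (hh : MonicSlopeGE (v M) h)
    (hdeg : h.natDegree = k M) : HasSlopes S v k g := by
  have hg : g.Monic := hh.monic.of_mul_monic_left hf.monic
  have hweight : ∀ s ∈ S, g ∈ weightGE (v s)
      (vertexExponent S v k (v s) + vertexDegree S v k (v s) • v s) := by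
    intro s hs
    have hMs : ¬ v M ≤ v s := (hlt s hs).not_ge
    have hdiv := (hh.anti (hlt s hs).le).divByMonic_mem_weightGE
      (hf.weight s (Finset.mem_insert_of_mem hs))
    rw [mul_divByMonic_cancel_left g hh.monic, vertexExponent_insert_of_not_le hMs,
      vertexDegree_insert_of_not_le hM hMs, hdeg] at hdiv
    exact weightGE_anti (le_of_eq (by module)) hdiv
  refine ⟨hg, ?_, fun s hs => ?_, hweight⟩
  · have hsum := hf.natDegree_eq
    rw [hh.monic.natDegree_mul hg, Finset.sum_insert hM, hdeg] at hsum
    exact add_left_cancel hsum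
  · have hMs : ¬ v M ≤ v s := (hlt s hs).not_ge
    obtain ⟨i, hi, hif⟩ := hf.vertex s (Finset.mem_insert_of_mem hs)
    rw [vertexExponent_insert_of_not_le hMs] at hi
    rw [vertexDegree_insert_of_not_le hM hMs, ← hdeg] at hif
    exact ⟨i, hi, coeff_coeff_ne_zero_of_mul (hlt s hs) (hi ▸ hweight s hs) hh hif⟩

theorem HasSlopes.singleton_of_insert_mul [DecidableEq ι]
    (hf : HasSlopes (insert M S) v k (h * g)) (hM : M ∉ S) (hle : ∀ t ∈ S, v t ≤ v M)
    (hc : IsChain (· ≤ ·) (v '' S)) (hh : MonicSlopeGE (v M) h) (hdeg : h.natDegree = k M)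
    (hg : HasSlopes S v k g) : HasSlopes {M} v k h := by
  have hexp : vertexExponent {M} v k (v M) = k M • v M := by
    rw [vertexExponent_of_forall_le (by simp), Finset.sum_singleton]
  have hdeg₀ : vertexDegree {M} v k (v M) = 0 := vertexDegree_of_forall_le (by simp)
  have hweight : h ∈ weightGE (v M) (k M • v M) := hdeg ▸ hh.mem_weightGE
  refine ⟨hh.monic, by simpa using hdeg, fun s hs => ?_, fun s hs => ?_⟩ <;>
    obtain rfl := Finset.mem_singleton.1 hs <;> rw [hexp, hdeg₀]
  · obtain ⟨i, hi, hif⟩ := hf.exists_vertex_of_forall_le (Finset.mem_insert_self s S)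
      fun t ht => (Finset.mem_insert.1 ht).elim (fun h => h ▸ le_rfl) (hle t)
    rw [mul_coeff_zero] at hif
    rw [Finset.sum_insert hM] at hi
    exact exists_coeff_ne_zero_of_coeff_mul (fun i hi => by simpa using hweight i 0 hi)
      (hg.sum_le_realExponent hc) hi hif
  · simpa using hweight

/-- The steepest slope is split off first. -/
theorem HasSlopes.exists_factorization (hpos : ∀ t ∈ S, 0 ≤ v t)
    (hc : IsChain (· ≤ ·) (v '' S)) (hinj : Set.InjOn v S) (hf : HasSlopes S v k f) :
    ∃ g : ι → (MvPowerSeries σ K)[X], f = ∏ t ∈ S, g t ∧ ∀ t ∈ S, HasSlopes {t} v k (g t) := by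
  classical
  induction S using Finset.strongInduction generalizing f with
  | H S ih =>
  rcases S.eq_empty_or_nonempty with rfl | hS
  · exact ⟨1, by simpa using eq_one_of_monic_natDegree_zero hf.monic hf.natDegree_eq, by simp⟩
  obtain ⟨M, hM, hmax⟩ := exists_forall_le_of_isChain hS hc
  have hlt : ∀ t ∈ S.erase M, v t < v M := fun t ht =>
    (hmax t (Finset.mem_of_mem_erase ht)).lt_of_ne fun h =>
      Finset.ne_of_mem_erase ht (hinj (Finset.mem_of_mem_erase ht) hM h)
  have hsub : (S.erase M : Set ι) ⊆ S := Finset.coe_subset.2 (S.erase_subset M)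
  have hc' : IsChain (· ≤ ·) (v '' (S.erase M : Set ι)) := hc.mono (Set.image_mono hsub)
  rw [← Finset.insert_erase hM] at hf
  obtain ⟨h, hh, hdeg, p, rfl⟩ :=
    hf.exists_monicSlopeGE_dvd (S.notMem_erase M) (hpos M hM) hlt hc'
  have hp := hf.of_insert_mul (S.notMem_erase M) hlt hh hdeg
  have hhM := hf.singleton_of_insert_mul (S.notMem_erase M) (fun t ht => (hlt t ht).le) hc' hh
    hdeg hp
  obtain ⟨g, hgp, hg⟩ := ih _ (Finset.erase_ssubset hM)
    (fun t ht => hpos t (Finset.mem_of_mem_erase ht)) hc' (hinj.mono hsub) hp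
  refine ⟨Function.update g M h, ?_, fun t ht => ?_⟩
  · rw [← Finset.mul_prod_erase S _ hM, Function.update_self, hgp]
    congr 1
    exact Finset.prod_congr rfl fun t ht =>
      (Function.update_of_ne (Finset.ne_of_mem_erase ht) _ _).symm
  · rcases eq_or_ne t M with rfl | hne
    · rwa [Function.update_self]
    · rw [Function.update_of_ne hne]
      exact hg t (Finset.mem_erase.2 ⟨hne, ht⟩)

end Slopes

/-! ### Exposed faces of Minkowski sums -/

section Exposed

variable {E : Type*} [AddCommGroup E] [Module ℝ E]

theorem vectorSpan_le_vectorSpan_add {A B : Set E} (hB : B.Nonempty) :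
    vectorSpan ℝ A ≤ vectorSpan ℝ (A + B) := by
  obtain ⟨b, hb⟩ := hB
  refine Submodule.span_mono ?_
  rintro _ ⟨a, ha, a', ha', rfl⟩
  exact ⟨a + b, Set.add_mem_add ha hb, a' + b, Set.add_mem_add ha' hb, add_sub_add_right_eq_sub ..⟩

variable [TopologicalSpace E] (l : StrongDual ℝ E)

theorem toExposed_add (A B : Set E) : l.toExposed (A + B) = l.toExposed A + l.toExposed B := by
  ext x
  constructor
  · rintro ⟨⟨a, ha, b, hb, rfl⟩, h⟩
    refine ⟨a, ⟨ha, fun a' ha' => ?_⟩, b, ⟨hb, fun b' hb' => ?_⟩, rfl⟩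
    · simpa using h _ (Set.add_mem_add ha' hb)
    · simpa using h _ (Set.add_mem_add ha hb')
  · rintro ⟨a, ⟨ha, hla⟩, b, ⟨hb, hlb⟩, rfl⟩
    refine ⟨Set.add_mem_add ha hb, ?_⟩
    rintro _ ⟨a', ha', b', hb', rfl⟩
    simpa only [map_add] using add_le_add (hla a' ha') (hlb b' hb')

theorem toExposed_singleton (x : E) : l.toExposed {x} = {x} := by
  ext y
  constructor
  · exact fun h => h.1
  · rintro rfl
    exact ⟨rfl, fun z hz => by rw [Set.mem_singleton_iff.1 hz]⟩

theorem toExposed_sum {ι : Type*} (S : Finset ι) (A : ι → Set E) :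
    l.toExposed (∑ t ∈ S, A t) = ∑ t ∈ S, l.toExposed (A t) := by
  classical
  induction S using Finset.induction_on with
  | empty => exact toExposed_singleton l 0
  | insert t S ht ih => rw [Finset.sum_insert ht, toExposed_add, ih, Finset.sum_insert ht]

theorem toExposed_segment_of_lt {x y : E} (h : l y < l x) :
    l.toExposed (segment ℝ x y) = {x} := by
  refine Set.Subset.antisymm ?_ (Set.singleton_subset_iff.2 ⟨left_mem_segment ℝ x y, ?_⟩)
  · rintro _ ⟨⟨a, b, ha, hb, hab, rfl⟩, hmax⟩
    have hle := hmax x (left_mem_segment ℝ x y)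
    obtain rfl : a = 1 - b := by linarith
    simp only [map_add, map_smul, smul_eq_mul] at hle
    obtain rfl : b = 0 := by nlinarith
    simp
  · rintro _ ⟨a, b, ha, hb, hab, rfl⟩
    obtain rfl : a = 1 - b := by linarith
    simp only [map_add, map_smul, smul_eq_mul]
    nlinarith

theorem toExposed_segment_of_eq {x y : E} (h : l x = l y) :
    l.toExposed (segment ℝ x y) = segment ℝ x y := by
  have hconst : ∀ z ∈ segment ℝ x y, l z = l y := by
    rintro _ ⟨a, b, -, -, hab, rfl⟩
    simp only [map_add, map_smul, h, smul_eq_mul, ← add_mul, hab, one_mul]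
  exact Set.Subset.antisymm (fun z hz => hz.1) fun z hz =>
    ⟨hz, fun z' hz' => by rw [hconst z hz, hconst z' hz']⟩

theorem toExposed_Ici_zero [PartialOrder E] (hl : ∀ x, 0 < x → l x < 0) :
    l.toExposed (Set.Ici 0) = {0} := by
  refine Set.Subset.antisymm (fun x hx => ?_) (Set.singleton_subset_iff.2
    ⟨le_rfl, fun x hx => ?_⟩)
  · by_contra hx0
    exact (hl x (lt_of_le_of_ne hx.1 (Ne.symm hx0))).not_ge (by simpa using hx.2 0 le_rfl)
  · rcases (Set.mem_Ici.1 hx).eq_or_lt with rfl | hx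
    · rfl
    · simpa using (hl x hx).le

theorem toExposed_nonempty {A : Set E} (hA : IsCompact A) (hne : A.Nonempty) :
    (l.toExposed A).Nonempty := by
  obtain ⟨x, hx, hmax⟩ := hA.exists_isMaxOn hne l.continuous.continuousOn
  exact ⟨x, hx, hmax⟩

theorem mem_of_toExposed_convexHull_eq_singleton {A : Set E} {x : E}
    (h : l.toExposed (convexHull ℝ A) = {x}) : x ∈ A := by
  refine extremePoints_convexHull_subset (𝕜 := ℝ) (isExtreme_singleton.1 ?_)
  rw [← h]
  exact ContinuousLinearMap.toExposed.isExposed.isExtreme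

theorem isCompact_segment [IsTopologicalAddGroup E] [ContinuousSMul ℝ E] (x y : E) :
    IsCompact (segment ℝ x y) := by
  rw [← convexHull_pair]
  exact (Set.toFinite _).isCompact_convexHull ℝ

end Exposed

/-! ### Newton polytopes -/

section Polytope

variable {K : Type*} [Field K] {d : ℕ} {f g : (MvPowerSeries (Fin d) K)[X]}

theorem Ici_zero_add_Ici_zero {E : Type*} [AddCommGroup E] [PartialOrder E] [IsOrderedAddMonoid E] :
    (Set.Ici 0 + Set.Ici 0 : Set E) = Set.Ici 0 :=
  Set.Subset.antisymm (by simpa using Set.Ici_add_Ici_subset (0 : E) 0) fun x hx =>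
    ⟨0, le_rfl, x, hx, zero_add x⟩

/-- The exponents `(i, j)` of the monomials `x^i y^j` of `f`, as points of `ℝ^d × ℝ`. -/
def supportPoints (f : (MvPowerSeries (Fin d) K)[X]) : Set ((Fin d → ℝ) × ℝ) :=
  {p | ∃ i j, MvPowerSeries.coeff i (f.coeff j) ≠ 0 ∧ (realExponent i, (j : ℝ)) = p}

theorem newtonPolytope_eq_convexHull_add :
    newtonPolytope f = convexHull ℝ (supportPoints f) + Set.Ici 0 := by
  rw [← (convex_Ici (𝕜 := ℝ) (0 : (Fin d → ℝ) × ℝ)).convexHull_eq, ← convexHull_add, newtonPolytope]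
  congr 1
  ext x
  simp only [Set.mem_iUnion, Set.mem_add, supportPoints, Set.mem_ofPred_eq, Set.mem_singleton_iff]
  constructor
  · rintro ⟨i, j, hij, _, rfl, o, ho, rfl⟩
    exact ⟨_, ⟨i, j, hij, rfl⟩, o, ho, rfl⟩
  · rintro ⟨_, ⟨i, j, hij, rfl⟩, o, ho, rfl⟩
    exact ⟨i, j, hij, _, rfl, o, ho, rfl⟩

theorem supportPoints_subset_newtonPolytope : supportPoints f ⊆ newtonPolytope f := fun p hp => by
  rw [newtonPolytope_eq_convexHull_add]
  exact ⟨p, subset_convexHull ℝ _ hp, 0, Set.self_mem_Ici, add_zero p⟩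

theorem newtonPolytope_add_Ici_zero : newtonPolytope f + Set.Ici 0 = newtonPolytope f := by
  rw [newtonPolytope_eq_convexHull_add, add_assoc, Ici_zero_add_Ici_zero]

theorem supportPoints_one : supportPoints (1 : (MvPowerSeries (Fin d) K)[X]) = {0} := by
  classical
  ext p
  simp only [supportPoints, coeff_one, Set.mem_ofPred_eq, Set.mem_singleton_iff]
  constructor
  · rintro ⟨i, j, hij, rfl⟩
    split_ifs at hij with hj
    · rw [MvPowerSeries.coeff_one] at hij
      obtain rfl : i = 0 := by by_contra h; simp [h] at hij
      ext <;> simp [realExponent, hj]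
    · simp at hij
  · rintro rfl
    refine ⟨0, 0, by simp, ?_⟩
    ext <;> simp [realExponent]

theorem supportPoints_X_pow_mul (N : ℕ) :
    supportPoints (X ^ N * g) = {(0, (N : ℝ))} + supportPoints g := by
  rw [Set.singleton_add]
  ext p
  constructor
  · rintro ⟨i, j, hij, rfl⟩
    rw [coeff_X_pow_mul'] at hij
    split_ifs at hij with hN
    · exact ⟨_, ⟨i, _, hij, rfl⟩, by ext <;> simp [hN]⟩
    · simp at hij
  · rintro ⟨_, ⟨i, j, hij, rfl⟩, rfl⟩
    exact ⟨i, j + N, by rwa [coeff_X_pow_mul], by ext <;> simp [add_comm]⟩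

theorem newtonPolytope_one :
    newtonPolytope (1 : (MvPowerSeries (Fin d) K)[X]) = Set.Ici 0 := by
  rw [newtonPolytope_eq_convexHull_add, supportPoints_one, convexHull_singleton]
  exact zero_add _

theorem newtonPolytope_X_pow_mul (N : ℕ) :
    newtonPolytope (X ^ N * g) = {(0, (N : ℝ))} + newtonPolytope g := by
  rw [newtonPolytope_eq_convexHull_add, supportPoints_X_pow_mul, convexHull_add,
    convexHull_singleton, add_assoc, ← newtonPolytope_eq_convexHull_add]

theorem exists_eq_X_pow_mul_of_newtonPolytope_eq {N : ℕ} {P : Set ((Fin d → ℝ) × ℝ)}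
    (hf : newtonPolytope f = {(0, (N : ℝ))} + P) (hP : P ⊆ Set.Ici 0) :
    ∃ g, f = X ^ N * g ∧ newtonPolytope g = P := by
  obtain ⟨g, rfl⟩ : X ^ N ∣ f := by
    refine X_pow_dvd_iff.2 fun j hj => ?_
    ext i
    by_contra hij
    have hmem := supportPoints_subset_newtonPolytope ⟨i, j, hij, rfl⟩
    rw [hf, Set.singleton_add] at hmem
    obtain ⟨o, ho, hij⟩ := hmem
    have hN : (N : ℝ) + o.2 = j := congrArg Prod.snd hij
    have ho₂ : 0 ≤ o.2 := (hP ho).2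
    exact hj.not_ge (Nat.cast_le (α := ℝ).1 (by linarith))
  rw [newtonPolytope_X_pow_mul] at hf
  exact ⟨g, rfl, (Set.isAddUnit_singleton _).add_left_cancel hf⟩

theorem isUnit_iff_coeff_zero_ne_zero {σ : Type*} {φ : MvPowerSeries σ K} :
    IsUnit φ ↔ MvPowerSeries.coeff 0 φ ≠ 0 := by
  rw [MvPowerSeries.isUnit_iff_constantCoeff, isUnit_iff_ne_zero,
    MvPowerSeries.coeff_zero_eq_constantCoeff_apply]

theorem IsWeierstrass.of_X_pow_mul {N : ℕ} (h : IsWeierstrass (X ^ N * g)) : IsWeierstrass g := by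
  have hg : g.Monic := (monic_X_pow N).of_mul_monic_left h.1
  refine ⟨hg, fun j hj => ?_⟩
  rw [← coeff_X_pow_mul g N j]
  refine h.2 _ ?_
  rw [(monic_X_pow N).natDegree_mul hg, natDegree_X_pow]
  lia

theorem isWeierstrass_X_pow (k : ℕ) : IsWeierstrass (X ^ k : (MvPowerSeries (Fin d) K)[X]) := by
  refine ⟨monic_X_pow k, fun j hj => ?_⟩
  rw [natDegree_X_pow] at hj
  rw [coeff_X_pow, if_neg hj.ne]
  exact not_isUnit_zero

theorem IsWeierstrass.natDegree_eq_of_coeff_zero_ne_zero (hf : IsWeierstrass f) {j : ℕ}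
    (hj : MvPowerSeries.coeff 0 (f.coeff j) ≠ 0) : f.natDegree = j :=
  le_antisymm (not_lt.1 fun h => hf.2 j h (isUnit_iff_coeff_zero_ne_zero.2 hj))
    (le_natDegree_of_ne_zero fun h => hj (by simp [h]))

/-- The linear form `(x, y) ↦ w ⬝ᵥ x + l y`. -/
noncomputable def pairing (w : Fin d → ℝ) (l : ℝ) : StrongDual ℝ ((Fin d → ℝ) × ℝ) :=
  ∑ a, w a • (ContinuousLinearMap.proj a).comp (ContinuousLinearMap.fst ℝ (Fin d → ℝ) ℝ) +
    l • ContinuousLinearMap.snd ℝ (Fin d → ℝ) ℝ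

variable {w : Fin d → ℝ} {l : ℝ}

theorem pairing_apply (p : (Fin d → ℝ) × ℝ) : pairing w l p = w ⬝ᵥ p.1 + l * p.2 := by
  simp [pairing, dotProduct]

theorem dotProduct_pos_of_pos {n : Type*} [Fintype n] {w x : n → ℝ} (hw : ∀ a, 0 < w a)
    (hx : 0 < x) : 0 < w ⬝ᵥ x := by
  obtain ⟨hx, a, ha⟩ := Pi.lt_def.1 hx
  exact Finset.sum_pos' (fun a _ => mul_nonneg (hw a).le (hx a))
    ⟨a, Finset.mem_univ a, mul_pos (hw a) ha⟩

theorem neg_pairing_neg (hw : ∀ a, 0 < w a) (hl : 0 < l) (p : (Fin d → ℝ) × ℝ) (hp : 0 < p) :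
    (-pairing w l) p < 0 := by
  rw [neg_apply, neg_lt_zero, pairing_apply]
  rcases Prod.lt_iff.1 hp with ⟨hx, hy⟩ | ⟨hx, hy⟩
  · exact add_pos_of_pos_of_nonneg (dotProduct_pos_of_pos hw hx) (mul_nonneg hl.le hy)
  · exact add_pos_of_nonneg_of_pos (dotProduct_nonneg_of_nonneg (fun a => (hw a).le) hx)
      (mul_pos hl hy)

theorem toExposed_newtonPolytope (hw : ∀ a, 0 < w a) (hl : 0 < l) :
    (-pairing w l).toExposed (newtonPolytope f) =
      (-pairing w l).toExposed (convexHull ℝ (supportPoints f)) := by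
  rw [newtonPolytope_eq_convexHull_add, toExposed_add,
    toExposed_Ici_zero _ (neg_pairing_neg hw hl)]
  exact add_zero _

end Polytope

/-! ### Sums of edges -/

section Edge

variable {d : ℕ} {ι : Type*} {S : Finset ι} {v : ι → Fin d → ℝ} {k : ι → ℕ} {w : Fin d → ℝ} {l : ℝ}

/-- The compact edge of `{k • v / k}`, whose inclination is `v`. -/
def edge (v : Fin d → ℝ) (k : ℕ) : Set ((Fin d → ℝ) × ℝ) := segment ℝ (k • v, 0) (0, (k : ℝ))

theorem edge_subset_Ici_zero {v : Fin d → ℝ} {k : ℕ} (hv : 0 ≤ v) : edge v k ⊆ Set.Ici 0 :=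
  (convex_Ici 0).segment_subset ⟨nsmul_nonneg hv k, le_rfl⟩ ⟨le_rfl, k.cast_nonneg⟩

theorem sum_edge_add_Ici_zero_subset (hv : ∀ t ∈ S, 0 ≤ v t) :
    ∑ t ∈ S, edge (v t) (k t) + Set.Ici 0 ⊆ Set.Ici 0 := by
  rintro _ ⟨p, hp, o, ho, rfl⟩
  obtain ⟨e, he, rfl⟩ := (Set.mem_finsetSum _ _ _).1 hp
  exact add_nonneg (Finset.sum_nonneg fun t ht => edge_subset_Ici_zero (hv t ht) (he ht))
    (Set.mem_Ici.1 ho)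

theorem pairing_edge_left {v : Fin d → ℝ} {k : ℕ} : pairing w l (k • v, 0) = k * w ⬝ᵥ v := by
  rw [pairing_apply, dotProduct_smul, mul_zero, add_zero, nsmul_eq_mul]

theorem pairing_edge_right {k : ℕ} : pairing w l (0, (k : ℝ)) = k * l := by
  simp [pairing_apply, mul_comm]

theorem toExposed_edge_of_lt {v : Fin d → ℝ} {k : ℕ} (hk : 0 < k) (h : w ⬝ᵥ v < l) :
    (-pairing w l).toExposed (edge v k) = {(k • v, 0)} := by
  refine toExposed_segment_of_lt _ ?_
  rw [neg_apply, neg_apply, neg_lt_neg_iff, pairing_edge_left, pairing_edge_right]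
  gcongr

theorem toExposed_edge_of_gt {v : Fin d → ℝ} {k : ℕ} (hk : 0 < k) (h : l < w ⬝ᵥ v) :
    (-pairing w l).toExposed (edge v k) = {(0, (k : ℝ))} := by
  rw [edge, segment_symm]
  refine toExposed_segment_of_lt _ ?_
  rw [neg_apply, neg_apply, neg_lt_neg_iff, pairing_edge_left, pairing_edge_right]
  gcongr

theorem toExposed_edge_of_eq {v : Fin d → ℝ} {k : ℕ} (h : w ⬝ᵥ v = l) :
    (-pairing w l).toExposed (edge v k) = edge v k := by
  refine toExposed_segment_of_eq _ ?_
  rw [neg_apply, neg_apply, pairing_edge_left, pairing_edge_right, h]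

theorem toExposed_sum_edge_add_Ici_zero (hw : ∀ a, 0 < w a) (hl : 0 < l) :
    (-pairing w l).toExposed (∑ t ∈ S, edge (v t) (k t) + Set.Ici 0) =
      ∑ t ∈ S, (-pairing w l).toExposed (edge (v t) (k t)) := by
  rw [toExposed_add, toExposed_Ici_zero _ (neg_pairing_neg hw hl), toExposed_sum]
  exact add_zero _

theorem isCompact_edge (v : Fin d → ℝ) (k : ℕ) : IsCompact (edge v k) := isCompact_segment _ _

theorem toExposed_edge_nonempty (L : StrongDual ℝ ((Fin d → ℝ) × ℝ)) (v : Fin d → ℝ) (k : ℕ) :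
    (L.toExposed (edge v k)).Nonempty :=
  toExposed_nonempty L (isCompact_edge v k) ⟨_, left_mem_segment ℝ _ _⟩

theorem sum_toExposed_edge_nonempty (L : StrongDual ℝ ((Fin d → ℝ) × ℝ)) :
    (∑ t ∈ S, L.toExposed (edge (v t) (k t))).Nonempty :=
  Finset.sum_induction _ Set.Nonempty (fun _ _ => Set.Nonempty.add) Set.zero_nonempty
    fun t _ => toExposed_edge_nonempty L (v t) (k t)

theorem isCompact_sum_toExposed_edge (L : StrongDual ℝ ((Fin d → ℝ) × ℝ)) :
    IsCompact (∑ t ∈ S, L.toExposed (edge (v t) (k t))) :=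
  Finset.sum_induction _ IsCompact (fun _ _ => IsCompact.add) isCompact_singleton
    fun t _ => ContinuousLinearMap.toExposed.isExposed.isCompact (isCompact_edge (v t) (k t))

theorem finrank_vectorSpan_sum_toExposed_edge_le_one {p : (Fin d → ℝ) × ℝ}
    (hP : IsPolygonal ({p} + (∑ t ∈ S, edge (v t) (k t) + Set.Ici 0)))
    (hw : ∀ a, 0 < w a) (hl : 0 < l) :
    Module.finrank ℝ (vectorSpan ℝ
      (∑ t ∈ S, (-pairing w l).toExposed (edge (v t) (k t)))) ≤ 1 := by
  have hface : (-pairing w l).toExposed ({p} + (∑ t ∈ S, edge (v t) (k t) + Set.Ici 0)) =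
      {p} + ∑ t ∈ S, (-pairing w l).toExposed (edge (v t) (k t)) := by
    rw [toExposed_add, toExposed_singleton, toExposed_sum_edge_add_Ici_zero hw hl]
  have hle := hP.2 ⟨_, ContinuousLinearMap.toExposed.isExposed (l := -pairing w l),
    hface ▸ (Set.singleton_nonempty p).add (sum_toExposed_edge_nonempty _),
    hface ▸ isCompact_singleton.add (isCompact_sum_toExposed_edge _), rfl⟩
  refine (Submodule.finrank_mono ?_).trans hle
  rw [hface, add_comm]
  exact vectorSpan_le_vectorSpan_add (Set.singleton_nonempty p)

theorem sub_mem_vectorSpan_sum_toExposed_edge {t : ι} (ht : t ∈ S) (h : w ⬝ᵥ v t = l) :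
    (k t • v t, -(k t : ℝ)) ∈ vectorSpan ℝ
      (∑ t ∈ S, (-pairing w l).toExposed (edge (v t) (k t))) := by
  classical
  rw [← Finset.add_sum_erase S _ ht, toExposed_edge_of_eq h]
  refine vectorSpan_le_vectorSpan_add (sum_toExposed_edge_nonempty _) ?_
  simpa [edge] using vsub_mem_vectorSpan ℝ (left_mem_segment ℝ (k t • v t, (0 : ℝ)) (0, (k t : ℝ)))
    (right_mem_segment ℝ _ _)

theorem eq_of_mem_of_finrank_le_one {E : Type*} [AddCommGroup E] [Module ℝ E]
    [Module.Finite ℝ E] {W : Submodule ℝ (E × ℝ)} (hW : Module.finrank ℝ W ≤ 1) {x y : E}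
    {m n : ℕ} (hm : 0 < m) (hn : 0 < n) (hx : (m • x, -(m : ℝ)) ∈ W)
    (hy : (n • y, -(n : ℝ)) ∈ W) : x = y := by
  obtain ⟨u, hu⟩ := finrank_le_one_iff.1 hW
  have hdir {z : E} {j : ℕ} (hj : 0 < j) (hz : (j • z, -(j : ℝ)) ∈ W) :
      (u : E × ℝ).2 ≠ 0 ∧ (u : E × ℝ).2 • z = -(u : E × ℝ).1 := by
    obtain ⟨b, hb⟩ := hu ⟨_, hz⟩
    have hb₁ : b • (u : E × ℝ).1 = j • z := congrArg (fun p : W => (p : E × ℝ).1) hb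
    have hb₂ : b * (u : E × ℝ).2 = -(j : ℝ) := congrArg (fun p : W => (p : E × ℝ).2) hb
    have hne : b * (u : E × ℝ).2 ≠ 0 := hb₂ ▸ neg_ne_zero.2 (Nat.cast_ne_zero.2 hj.ne')
    refine ⟨right_ne_zero_of_mul hne, smul_right_injective E (left_ne_zero_of_mul hne) ?_⟩
    dsimp only
    rw [smul_smul, hb₂, smul_neg, hb₁, neg_smul, Nat.cast_smul_eq_nsmul]
  exact smul_right_injective E (hdir hm hx).1 ((hdir hm hx).2.trans (hdir hn hy).2.symm)

theorem exists_pos_dotProduct_eq_zero {n : Type*} [Fintype n] {z : n → ℝ} (h : ¬ z ≤ 0)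
    (h' : ¬ 0 ≤ z) : ∃ w : n → ℝ, (∀ a, 0 < w a) ∧ w ⬝ᵥ z = 0 := by
  classical
  obtain ⟨c, hc, hpos⟩ : ∃ c, z c ≠ 0 ∧ 0 ≤ -(∑ a, z a) / z c := by
    simp only [Pi.le_def, not_forall, not_le] at h h'
    obtain ⟨a, ha⟩ := h
    obtain ⟨b, hb⟩ := h'
    rcases le_total (∑ a, z a) 0 with hsum | hsum
    · exact ⟨a, ha.ne', div_nonneg (neg_nonneg.2 hsum) ha.le⟩
    · exact ⟨b, hb.ne, div_nonneg_of_nonpos (neg_nonpos.2 hsum) hb.le⟩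
  refine ⟨1 + Pi.single c (-(∑ a, z a) / z c), fun a => ?_, ?_⟩
  · have : (0 : n → ℝ) ≤ Pi.single c (-(∑ a, z a) / z c) := Pi.single_nonneg.2 hpos
    exact add_pos_of_pos_of_nonneg one_pos (this a)
  · rw [add_dotProduct, one_dotProduct, single_dotProduct, div_mul_cancel₀ _ hc, add_neg_cancel]

/-- Two incomparable inclinations are equal on some positive linear form, so the face exposed by
it contains both edges. -/
theorem isChain_of_isPolygonal {p : (Fin d → ℝ) × ℝ} (hv : ∀ t ∈ S, 0 ≤ v t)
    (hk : ∀ t ∈ S, 0 < k t) (hP : IsPolygonal ({p} + (∑ t ∈ S, edge (v t) (k t) + Set.Ici 0))) :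
    IsChain (· ≤ ·) (v '' S) := by
  rintro _ ⟨s, hs, rfl⟩ _ ⟨t, ht, rfl⟩ -
  by_contra! hst
  obtain ⟨w, hw, hwz⟩ := exists_pos_dotProduct_eq_zero (z := v s - v t)
    (by simpa using hst.1) (by simpa using hst.2)
  rw [dotProduct_sub, sub_eq_zero] at hwz
  have hl : 0 < w ⬝ᵥ v s := dotProduct_pos_of_pos hw <|
    (hv s hs).lt_of_ne fun h => hst.1 (h ▸ hv t ht)
  have hrank := finrank_vectorSpan_sum_toExposed_edge_le_one hP hw hl
  have heq := eq_of_mem_of_finrank_le_one hrank (hk s hs) (hk t ht)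
    (sub_mem_vectorSpan_sum_toExposed_edge hs rfl)
    (sub_mem_vectorSpan_sum_toExposed_edge ht hwz.symm)
  exact hst.1 heq.le

end Edge

/-! ### Slopes and Newton polytopes -/

section SlopesOfPolytope

variable {K : Type*} [Field K] {d : ℕ} {f g : (MvPowerSeries (Fin d) K)[X]} {ι : Type*}
  {S : Finset ι} {v : ι → Fin d → ℝ} {k : ι → ℕ} {w : Fin d → ℝ} {l : ℝ}

theorem vertex_mem_supportPoints
    (hf : newtonPolytope f = ∑ t ∈ S, edge (v t) (k t) + Set.Ici 0) (hk : ∀ t ∈ S, 0 < k t)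
    {u : Fin d → ℝ} (hu : ∀ a, 0 < u a) (hl : 0 < l)
    (hlt : ∀ t ∈ S, v t ≤ w → u ⬝ᵥ v t < l) (hgt : ∀ t ∈ S, ¬ v t ≤ w → l < u ⬝ᵥ v t) :
    (vertexExponent S v k w, (vertexDegree S v k w : ℝ)) ∈ supportPoints f := by
  classical
  refine mem_of_toExposed_convexHull_eq_singleton (-pairing u l) ?_
  rw [← toExposed_newtonPolytope hu hl, hf, toExposed_sum_edge_add_Ici_zero hu hl]
  have hface : ∀ t ∈ S, (-pairing u l).toExposed (edge (v t) (k t)) =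
      {(if v t ≤ w then k t • v t else 0, ((if ¬ v t ≤ w then k t else 0 : ℕ) : ℝ))} := by
    intro t ht
    split_ifs with h
    · rw [toExposed_edge_of_lt (hk t ht) (hlt t ht h), Nat.cast_zero]
    · rw [toExposed_edge_of_gt (hk t ht) (hgt t ht h)]
  rw [Finset.sum_congr rfl hface, Set.finsetSum_singleton, ← prod_mk_sum,
    ← Nat.cast_sum, ← Finset.sum_filter, ← Finset.sum_filter]
  rfl

theorem exists_separating {n : Type*} [Fintype n] {v : ι → n → ℝ} {w : n → ℝ}
    (hw : 0 ≤ w) (hcomp : ∀ t ∈ S, v t ≤ w ∨ w ≤ v t) :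
    ∃ l > 0, ∀ t ∈ S, (v t ≤ w → 1 ⬝ᵥ v t < l) ∧ (¬ v t ≤ w → l < 1 ⬝ᵥ v t) := by
  have hgt : ∀ᶠ l in nhdsWithin (1 ⬝ᵥ w) (Set.Ioi (1 ⬝ᵥ w)),
      ∀ t ∈ S, ¬ v t ≤ w → l < 1 ⬝ᵥ v t := by
    refine (eventually_all_finset S).2 fun t ht => ?_
    by_cases htw : v t ≤ w
    · exact .of_forall fun _ h => absurd htw h
    have hlt : 1 ⬝ᵥ w < 1 ⬝ᵥ v t := by
      have := dotProduct_pos_of_pos (w := 1) (fun _ => one_pos)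
        (sub_pos.2 (((hcomp t ht).resolve_left htw).lt_of_ne fun h => htw h.ge))
      rwa [dotProduct_sub, sub_pos] at this
    filter_upwards [Ioo_mem_nhdsGT hlt] with l hl _ using hl.2
  obtain ⟨l, hgt, hl⟩ := (hgt.and self_mem_nhdsWithin).exists
  have hw₁ : 0 ≤ 1 ⬝ᵥ w := dotProduct_nonneg_of_nonneg zero_le_one hw
  exact ⟨l, hw₁.trans_lt hl, fun t ht =>
    ⟨fun h => (dotProduct_le_dotProduct_of_nonneg_left h zero_le_one).trans_lt hl, hgt t ht⟩⟩

theorem exists_vertex_of_newtonPolytope_eq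
    (hf : newtonPolytope f = ∑ t ∈ S, edge (v t) (k t) + Set.Ici 0) (hk : ∀ t ∈ S, 0 < k t)
    (hw : 0 ≤ w) (hcomp : ∀ t ∈ S, v t ≤ w ∨ w ≤ v t) :
    ∃ i, realExponent i = vertexExponent S v k w ∧
      MvPowerSeries.coeff i (f.coeff (vertexDegree S v k w)) ≠ 0 := by
  obtain ⟨l, hl, hsep⟩ := exists_separating hw hcomp
  obtain ⟨i, j, hij, hp⟩ := vertex_mem_supportPoints hf hk (u := 1) (fun _ => one_pos) hl
    (fun t ht => (hsep t ht).1) fun t ht => (hsep t ht).2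
  obtain ⟨hi, hj⟩ := Prod.ext_iff.1 hp
  exact ⟨i, hi, Nat.cast_injective (R := ℝ) hj ▸ hij⟩

theorem le_weight_of_mem_edge {u c : Fin d → ℝ} {n : ℕ} (hu : c ≤ n • u) (hw : c ≤ n • w)
    {p : (Fin d → ℝ) × ℝ} (hp : p ∈ edge u n) : c ≤ p.1 + p.2 • w := by
  let weight : (Fin d → ℝ) × ℝ →ₗ[ℝ] Fin d → ℝ :=
    LinearMap.fst ℝ _ ℝ + (LinearMap.snd ℝ (Fin d → ℝ) ℝ).smulRight w
  refine ((convex_Ici c).linear_preimage weight).segment_subset ?_ ?_ hp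
  · simpa [weight] using hu
  · simpa [weight, -nsmul_eq_mul, Nat.cast_smul_eq_nsmul] using hw

theorem le_weight_of_mem_sum_edge_add_Ici_zero (hw : 0 ≤ w)
    (hcomp : ∀ t ∈ S, v t ≤ w ∨ w ≤ v t) {p : (Fin d → ℝ) × ℝ}
    (hp : p ∈ ∑ t ∈ S, edge (v t) (k t) + Set.Ici 0) :
    vertexExponent S v k w + vertexDegree S v k w • w ≤ p.1 + p.2 • w := by
  classical
  obtain ⟨_, hsum, o, ho, rfl⟩ := Set.mem_add.1 hp
  obtain ⟨e, he, rfl⟩ := (Set.mem_finsetSum _ _ _).1 hsum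
  have hedge : ∀ t ∈ S, (if v t ≤ w then k t • v t else k t • w) ≤ (e t).1 + (e t).2 • w := by
    intro t ht
    refine le_weight_of_mem_edge ?_ ?_ (he ht) <;> split_ifs with h
    · rfl
    · exact nsmul_le_nsmul_right ((hcomp t ht).resolve_left h) _
    · exact nsmul_le_nsmul_right h _
    · rfl
  have hle := Finset.sum_le_sum hedge
  rw [Finset.sum_ite, ← Finset.sum_smul, Finset.sum_add_distrib, ← Finset.sum_smul] at hle
  refine hle.trans ?_
  rw [Prod.fst_add, Prod.snd_add, Prod.fst_sum, Prod.snd_sum]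
  gcongr
  · exact le_add_of_nonneg_right ho.1
  · exact le_add_of_nonneg_right ho.2

theorem HasSlopes.of_newtonPolytope_eq (hW : IsWeierstrass f)
    (hf : newtonPolytope f = ∑ t ∈ S, edge (v t) (k t) + Set.Ici 0) (hk : ∀ t ∈ S, 0 < k t)
    (hv : ∀ t ∈ S, 0 < v t) (hc : IsChain (· ≤ ·) (v '' S)) : HasSlopes S v k f := by
  classical
  have hcomp : ∀ s ∈ S, ∀ t ∈ S, v t ≤ v s ∨ v s ≤ v t := fun s hs t ht =>
    hc.total (Set.mem_image_of_mem v ht) (Set.mem_image_of_mem v hs)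
  have hdeg : f.natDegree = ∑ t ∈ S, k t := by
    obtain ⟨i, hi, hif⟩ := exists_vertex_of_newtonPolytope_eq hf hk le_rfl
      fun t ht => Or.inr (hv t ht).le
    have hS : ∀ t ∈ S, ¬ v t ≤ 0 := fun t ht => (hv t ht).not_ge
    rw [vertexExponent, Finset.filter_false_of_mem hS, Finset.sum_empty] at hi
    rw [vertexDegree, Finset.filter_true_of_mem hS] at hif
    obtain rfl : i = 0 := nonpos_iff_eq_zero.1 <| realExponent_le_realExponent.1 <|
      hi.le.trans (realExponent_nonneg 0)
    exact hW.natDegree_eq_of_coeff_zero_ne_zero hif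
  refine ⟨hW.1, hdeg, fun s hs => ?_, fun s hs i j hij => ?_⟩
  · exact exists_vertex_of_newtonPolytope_eq hf hk (hv s hs).le (hcomp s hs)
  · have hp := supportPoints_subset_newtonPolytope ⟨i, j, hij, rfl⟩
    rw [hf] at hp
    simpa only [Nat.cast_smul_eq_nsmul] using
      le_weight_of_mem_sum_edge_add_Ici_zero (hv s hs).le (hcomp s hs) hp

variable {t : ι}

theorem HasSlopes.mem_weightGE_nsmul (hg : HasSlopes {t} v k g) :
    g ∈ weightGE (v t) (k t • v t) := by
  simpa using hg.mem_weightGE_of_forall_le (Finset.mem_singleton_self t) (by simp)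

theorem HasSlopes.supportPoints_subset (hg : HasSlopes {t} v k g) (hk : 0 < k t) :
    supportPoints g ⊆ edge (v t) (k t) + Set.Ici 0 := by
  rintro _ ⟨i, j, hij, rfl⟩
  have hj : j ≤ k t := by
    simpa [hg.natDegree_eq] using
      le_natDegree_of_ne_zero fun h0 : g.coeff j = 0 => hij (by simp [h0])
  have hk' : (0 : ℝ) < k t := Nat.cast_pos.2 hk
  have hj' : (j : ℝ) / k t ≤ 1 := (div_le_one hk').2 (Nat.cast_le.2 hj)
  refine Set.mem_add.2 ⟨_, ⟨1 - j / k t, j / k t, sub_nonneg.2 hj', by positivity,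
    sub_add_cancel _ _, rfl⟩, _, Set.mem_Ici.2 (sub_nonneg.2 ?_), add_sub_cancel _ _⟩
  have hweight := hg.mem_weightGE_nsmul i j hij
  refine ⟨fun a => ?_, ?_⟩
  · have := hweight a
    simp only [Prod.fst_add, Prod.smul_fst, smul_zero, Pi.smul_apply,
      Pi.add_apply, Pi.zero_apply, add_zero] at this ⊢
    simp only [smul_eq_mul, nsmul_eq_mul] at this ⊢
    field_simp
    linarith
  · simp [div_mul_cancel₀ _ hk'.ne']

theorem HasSlopes.edge_subset (hg : HasSlopes {t} v k g) :
    edge (v t) (k t) ⊆ convexHull ℝ (supportPoints g) := by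
  refine (convex_convexHull ℝ _).segment_subset (subset_convexHull ℝ _ ?_)
    (subset_convexHull ℝ _ ?_)
  · obtain ⟨i, hi, hig⟩ := hg.exists_vertex_of_forall_le (Finset.mem_singleton_self t) (by simp)
    exact ⟨i, 0, hig, by simpa using hi⟩
  · have hdeg : g.natDegree = k t := by simpa using hg.natDegree_eq
    have hlead := hg.monic.coeff_natDegree
    rw [hdeg] at hlead
    exact ⟨0, k t, by simp [hlead], by rw [realExponent_zero]⟩

theorem HasSlopes.newtonPolytope_eq (hg : HasSlopes {t} v k g) (hk : 0 < k t) :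
    newtonPolytope g = edge (v t) (k t) + Set.Ici 0 := by
  rw [newtonPolytope_eq_convexHull_add]
  refine Set.Subset.antisymm ?_ (Set.add_subset_add_right hg.edge_subset)
  have hconv : Convex ℝ (edge (v t) (k t) + Set.Ici 0) := (convex_segment _ _).add (convex_Ici 0)
  have := convexHull_min (hg.supportPoints_subset hk) hconv
  refine (Set.add_subset_add_right this).trans ?_
  rw [add_assoc, Ici_zero_add_Ici_zero]

theorem HasSlopes.isWeierstrass (hg : HasSlopes {t} v k g) (hv : 0 < v t) : IsWeierstrass g := by
  refine ⟨hg.monic, fun j hj hunit => ?_⟩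
  have hdeg : g.natDegree = k t := by simpa using hg.natDegree_eq
  have hle := hg.mem_weightGE_nsmul 0 j (isUnit_iff_coeff_zero_ne_zero.1 hunit)
  rw [realExponent_zero, zero_add] at hle
  exact (nsmul_lt_nsmul_left hv (hdeg ▸ hj)).not_ge hle

end SlopesOfPolytope

/-! ### Canonical representations -/

section Canonical

variable {K : Type*} [Field K] {d : ℕ} {ι : Type*}

/-- The inclination `q / k` as a real vector, the slope of the compact edge of `{q / k}`. The value
at `q = ∞`, where there is no such edge, is `0`. -/
noncomputable def realInclination (q : WithTop (Fin d → ℚ≥0)) (k : ℕ) : Fin d → ℝ :=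
  fun a => ((inclination q k).untopD 0 a : ℝ)

theorem realInclination_nonneg (q : WithTop (Fin d → ℚ≥0)) (k : ℕ) : 0 ≤ realInclination q k :=
  fun _ => NNRat.cast_nonneg _

theorem nsmul_realInclination_coe (u : Fin d → ℚ≥0) {k : ℕ} (hk : 0 < k) :
    k • realInclination (u : WithTop (Fin d → ℚ≥0)) k = fun a => ((u a : ℚ) : ℝ) := by
  ext a
  have : (k : ℝ) ≠ 0 := Nat.cast_ne_zero.2 hk.ne'
  simp [realInclination, inclination, mul_div_cancel₀, this]

theorem realInclination_pos {q : WithTop (Fin d → ℚ≥0)} {k : ℕ} (hk : 0 < k) (htop : q ≠ ⊤)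
    (h0 : q ≠ 0) : 0 < realInclination q k := by
  lift q to Fin d → ℚ≥0 using htop
  refine (realInclination_nonneg _ k).lt_of_ne fun h => h0 ?_
  have hq := nsmul_realInclination_coe q hk
  rw [← h, smul_zero] at hq
  exact congrArg _ (funext fun a => by simpa using (congrFun hq a).symm)

theorem injOn_realInclination {q : ι → WithTop (Fin d → ℚ≥0)} {k : ι → ℕ}
    (hinj : Function.Injective fun t => inclination (q t) (k t)) :
    Set.InjOn (fun t => realInclination (q t) (k t)) {t | q t ≠ ⊤} := by
  intro s hs t ht (hst : realInclination (q s) (k s) = realInclination (q t) (k t))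
  refine hinj ?_
  obtain ⟨u, hu⟩ := WithTop.ne_top_iff_exists.1 hs
  obtain ⟨u', hu'⟩ := WithTop.ne_top_iff_exists.1 ht
  rw [← hu, ← hu'] at hst
  simp only [← hu, ← hu', inclination, WithTop.map_coe]
  exact congrArg _ (funext fun a => NNRat.cast_injective (congrFun hst a))

theorem elementary_top (k : ℕ) :
    elementary (⊤ : WithTop (Fin d → ℚ≥0)) k = {(0, (k : ℝ))} + Set.Ici 0 := rfl

theorem elementary_eq_edge_add {q : WithTop (Fin d → ℚ≥0)} {k : ℕ} (hk : 0 < k) (htop : q ≠ ⊤) :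
    elementary q k = edge (realInclination q k) k + Set.Ici 0 := by
  lift q to Fin d → ℚ≥0 using htop
  rw [edge, nsmul_realInclination_coe q hk, ← convexHull_pair,
    ← (convex_Ici (𝕜 := ℝ) (0 : (Fin d → ℝ) × ℝ)).convexHull_eq, ← convexHull_add]
  rfl

theorem elementary_zero {k : ℕ} (hk : 0 < k) :
    elementary (0 : WithTop (Fin d → ℚ≥0)) k = Set.Ici 0 := by
  have hzero : realInclination (0 : WithTop (Fin d → ℚ≥0)) k = 0 := by
    ext
    simp [realInclination, inclination]
  rw [elementary_eq_edge_add hk WithTop.zero_ne_top, hzero]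
  refine Set.Subset.antisymm ?_ fun p hp => ?_
  · refine (Set.add_subset_add_right (edge_subset_Ici_zero le_rfl)).trans ?_
    rw [Ici_zero_add_Ici_zero]
  · refine ⟨0, ?_, p, hp, zero_add p⟩
    rw [edge, smul_zero]
    exact left_mem_segment ℝ 0 _

theorem newtonPolytope_X_pow (k : ℕ) :
    newtonPolytope (X ^ k : (MvPowerSeries (Fin d) K)[X]) = elementary ⊤ k := by
  rw [← mul_one (X ^ k), newtonPolytope_X_pow_mul, newtonPolytope_one, elementary_top]

theorem sum_add_Ici_zero {E : Type*} [AddCommGroup E] [PartialOrder E] [IsOrderedAddMonoid E]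
    (S : Finset ι) (A : ι → Set E) :
    ∑ t ∈ S, (A t + Set.Ici 0) + Set.Ici 0 = ∑ t ∈ S, A t + Set.Ici 0 := by
  classical
  induction S using Finset.induction_on with
  | empty => rfl
  | insert s S hs ih =>
    rw [Finset.sum_insert hs, Finset.sum_insert hs, add_assoc, ih, add_add_add_comm,
      Ici_zero_add_Ici_zero]

open scoped Classical in
theorem sum_elementary_add_Ici_zero (S : Finset ι) {q : ι → WithTop (Fin d → ℚ≥0)} {k : ι → ℕ}
    (hk : ∀ t ∈ S, 0 < k t) :
    ∑ t ∈ S, elementary (q t) (k t) + Set.Ici 0 =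
      {(0, ((∑ t ∈ S with q t = ⊤, k t : ℕ) : ℝ))} +
        (∑ t ∈ S with q t ≠ ⊤ ∧ q t ≠ 0, edge (realInclination (q t) (k t)) (k t) + Set.Ici 0) := by
  have helem : ∀ t ∈ S, elementary (q t) (k t) =
      (if q t = ⊤ then {(0, (k t : ℝ))}
        else if q t ≠ 0 then edge (realInclination (q t) (k t)) (k t) else 0) + Set.Ici 0 := by
    intro t ht
    split_ifs with htop h0
    · rw [htop, elementary_top]
    · exact elementary_eq_edge_add (hk t ht) htop
    · rw [not_not.1 h0, elementary_zero (hk t ht), zero_add]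
  rw [Finset.sum_congr rfl helem, sum_add_Ici_zero, Finset.sum_ite, ← Finset.sum_filter,
    Finset.filter_filter, Set.finsetSum_singleton, ← prod_mk_sum, Finset.sum_const_zero,
    ← Nat.cast_sum, add_assoc]

end Canonical

end NewtonPoly

open NewtonPoly Polynomial

theorem mainTheorem9 {K : Type*} [Field K] {d r : ℕ}
    (f : Polynomial (MvPowerSeries (Fin d) K)) (hf : NewtonPoly.IsWeierstrass f)
    (hpoly : NewtonPoly.IsPolygonal (NewtonPoly.newtonPolytope f))
    (q : Fin r → WithTop (Fin d → ℚ≥0)) (k : Fin r → ℕ)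
    (hrep : NewtonPoly.IsCanonicalRep (NewtonPoly.newtonPolytope f) q k) :
    ∃ g : Fin r → Polynomial (MvPowerSeries (Fin d) K),
      f = ∏ i, g i ∧
      ∀ i, NewtonPoly.IsWeierstrass (g i) ∧
        NewtonPoly.newtonPolytope (g i) = NewtonPoly.elementary (q i) (k i) := by
  classical
  obtain ⟨hk, hinj, hrep⟩ := hrep
  let S : Finset (Fin r) := {t | q t ≠ ⊤ ∧ q t ≠ 0}
  have hv : ∀ t ∈ S, 0 < realInclination (q t) (k t) := fun t ht =>
    realInclination_pos (hk t) (Finset.mem_filter.1 ht).2.1 (Finset.mem_filter.1 ht).2.2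
  have hP := sum_elementary_add_Ici_zero Finset.univ (q := q) fun t _ => hk t
  rw [← hrep, newtonPolytope_add_Ici_zero] at hP
  have hchain := isChain_of_isPolygonal (fun t ht => (hv t ht).le) (fun t _ => hk t) (hP ▸ hpoly)
  obtain ⟨h, rfl, hh⟩ := exists_eq_X_pow_mul_of_newtonPolytope_eq hP
    (sum_edge_add_Ici_zero_subset fun t ht => (hv t ht).le)
  obtain ⟨g, rfl, hg⟩ :=
    (HasSlopes.of_newtonPolytope_eq hf.of_X_pow_mul hh (fun t _ => hk t) hv hchain
      ).exists_factorization (fun t ht => (hv t ht).le) hchain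
      ((injOn_realInclination hinj).mono fun t ht => (Finset.mem_filter.1 ht).2.1)
  refine ⟨fun t => if q t = ⊤ then X ^ k t else if q t ≠ 0 then g t else 1, ?_, fun t => ?_⟩
  · rw [Finset.prod_ite, ← Finset.prod_filter, Finset.filter_filter, Finset.prod_pow_eq_pow_sum]
  dsimp only
  split_ifs with htop h0
  · rw [htop]
    exact ⟨isWeierstrass_X_pow _, newtonPolytope_X_pow _⟩
  · have htS : t ∈ S := Finset.mem_filter.2 ⟨Finset.mem_univ t, htop, h0⟩
    rw [elementary_eq_edge_add (hk t) htop]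
    exact ⟨(hg t htS).isWeierstrass (hv t htS), (hg t htS).newtonPolytope_eq (hk t)⟩
  · rw [not_not.1 h0, elementary_zero (hk t), newtonPolytope_one]
    exact ⟨isWeierstrass_X_pow 0, rfl⟩
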